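/- For real $\nu$ and $x>0$ let $K_\nu(x)=\int_0^\infty e^{-x\cosh t}\cosh(\nu t)\,dt$ be the modified Bessel function of the second kind. Let $n\ge 0$ be an integer. (1) There are real coefficients $(c_j)_{j\ge0}$ such that $$\sqrt{\tfrac{2}{\pi}}\,K_{n+1/2}(r)\,r^{n+1/2}=\sum_{j=0}^\infty c_j r^j\qquad\text{for all } r>0,$$ with convergent series. In every such expansion the first term that is not an even power of $r$ is the polyharmonic kernel $$\frac{(-1)^{n+1}}{(2n+1)(2n-1)(2n-3)\cdots 1}\,r^{2n+1}=\frac{(-1)^{n+1}2^n\,n!}{(2n+1)!}\,r^{2n+1};$$ that is, $c_j=0$ for every odd $j<2n+1$, and $c_{2n+1}$ is the (nonzero) coefficient displayed. (2) There are real coefficients $(a_j)_{j\ge0}$, $(b_j)_{j\ge0}$ such that $$K_n(r)\,r^n=\sum_{j=0}^\infty a_j r^j+\log r\,\sum_{j=0}^\infty b_j r^j\qquad\text{for all } r>0,$$ with both series convergent. In every such expansion the first term that is not an even power of $r$ is the polyharmonic kernel $$(-1)^{n+1}\,\frac{2^{-n}}{n!}\,r^{2n}\log r;$$ that is, $b_j=0$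 for every $j<2n$, $a_j=0$ for every odd $j<2n$, and $b_{2n}=(-1)^{n+1}2^{-n}/n!\neq 0$. -/

import Mathlib

noncomputable section

/-- The modified Bessel function of the second kind, of real order `ν`, at `x > 0`:
`K_ν(x) = ∫_0^∞ exp(-x cosh t) cosh(ν t) dt`. The integral converges absolutely for every real `ν`
and every `x > 0`; only such `x` are ever used. -/
def besselK (ν x : ℝ) : ℝ :=
  ∫ t in Set.Ioi (0 : ℝ), Real.exp (-x * Real.cosh t) * Real.cosh (ν * t)

/-- `f(r) = ∑ⱼ c j * r ^ j` for every `r > 0`, the series being convergent. -/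
def IsPowerExpansion (f : ℝ → ℝ) (c : ℕ → ℝ) : Prop :=
  ∀ r : ℝ, 0 < r → HasSum (fun j : ℕ => c j * r ^ j) (f r)

/-- `f(r) = ∑ⱼ a j * r ^ j + ∑ⱼ b j * r ^ j * log r` for every `r > 0`, where the power series
with coefficients `a` and `b` both converge. -/
def IsLogPowerExpansion (f : ℝ → ℝ) (a b : ℕ → ℝ) : Prop :=
  ∀ r : ℝ, 0 < r →
    Summable (fun j : ℕ => a j * r ^ j) ∧ Summable (fun j : ℕ => b j * r ^ j) ∧
      f r = (∑' j : ℕ, a j * r ^ j) + (∑' j : ℕ, b j * r ^ j) * Real.log r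

/-- In the expansion `∑ⱼ c j * r ^ j` the first term that is not an even power of `r` is
`A * r ^ m`: the exponent `m` is odd, `A ≠ 0`, and no odd power of smaller exponent occurs. -/
def IsFirstNonEvenPower (c : ℕ → ℝ) (m : ℕ) (A : ℝ) : Prop :=
  Odd m ∧ A ≠ 0 ∧ c m = A ∧ ∀ j < m, Odd j → c j = 0

/-- In the expansion `∑ⱼ a j * r ^ j + ∑ⱼ b j * r ^ j * log r` the first term that is not an even
power of `r` is `A * r ^ m * log r`: `A ≠ 0`, no logarithmic term of exponent smaller than `m`
occurs, and no odd power of exponent at most `m` occurs. -/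
def IsFirstNonEvenLog (a b : ℕ → ℝ) (m : ℕ) (A : ℝ) : Prop :=
  A ≠ 0 ∧ b m = A ∧ (∀ j < m, b j = 0) ∧ ∀ j ≤ m, Odd j → a j = 0

end

/-!
Write `F_ν(r) = K_ν(r) r ^ ν`. Differentiation under the integral sign and one integration by parts
give `F_{ν+1}'(r) = -r F_ν(r)` (`hasDerivAt_besselK_mul_rpow`). Integrating a series termwise, every
expansion `F_ν = ∑ a_j r ^ j + log r ∑ b_j r ^ j` therefore yields one of `F_{ν+1}`, with
`b'_{j+2} = -b_j / (j + 2)`, `a'_{j+2} = -a_j / (j + 2) + b_j / (j + 2) ^ 2` and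
`b'_0 = b'_1 = a'_1 = 0` (`IsLogPowerExpansion.raise`). So the first term that is not an even power
moves up by two degrees, and its coefficient is divided by minus the new degree; it remains to know
`F_{1/2}` and `F_0`.

The substitution `u = sinh (t / 2)` gives `√(2 / π) F_{1/2}(r) = exp (-r)`, whose first odd term is
`-r`. For `F_0 = K_0`, the modified Bessel equation has the solutions `I_0` and `I_0 log + S`, with
`S` an entire power series, and the Wronskian of any two solutions is a constant divided by `x`. By
Cramer's rule `K_0` is a combination of these two, and the coefficient of the second one is
`lim x K_0'(x) = -lim x K_1(x) = -1` as `x → 0`, because `exp (-x) ≤ x K_1(x) ≤ 1`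
(`exists_besselK_zero_eq`).

Finally, an expansion `∑ a_j r ^ j + log r ∑ b_j r ^ j` valid for all `r > 0` has unique coefficients
(`IsLogPowerExpansion.unique`), so that the properties of the expansions found hold for all. Pure
power series are treated as the case `b = 0`.
-/

open Set Filter Topology MeasureTheory

/-! ### Everywhere convergent power series -/

/-- The real power series with coefficients `c` converges at every positive real number (hence
absolutely at every real number). -/
def IsEntireSeries (c : ℕ → ℝ) : Prop :=
  ∀ r : ℝ, 0 < r → Summable fun j : ℕ => c j * r ^ j

/-- The sum `∑ⱼ c j * x ^ j`; used only for coefficients with `IsEntireSeries c`. -/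
noncomputable def powerSum (c : ℕ → ℝ) (x : ℝ) : ℝ :=
  ∑' j : ℕ, c j * x ^ j

/-- Coefficients of the formal derivative. -/
def derivCoeff (c : ℕ → ℝ) (j : ℕ) : ℝ :=
  ((j : ℝ) + 1) * c (j + 1)

/-- Coefficients of the series with the constant term removed and one factor `x` divided out. -/
def shiftCoeff (c : ℕ → ℝ) (j : ℕ) : ℝ :=
  c (j + 1)

namespace IsEntireSeries

variable {c d : ℕ → ℝ}

theorem summable_abs (hc : IsEntireSeries c) {r : ℝ} (hr : 0 < r) :
    Summable fun j : ℕ => |c j| * r ^ j := by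
  refine (hc r hr).abs.congr fun j => ?_
  rw [abs_mul, abs_of_pos (pow_pos hr j)]

theorem of_abs_le (hd : IsEntireSeries d) (h : ∀ j, |c j| ≤ |d j|) : IsEntireSeries c := by
  intro r hr
  refine Summable.of_norm_bounded (hd.summable_abs hr) fun j => ?_
  rw [Real.norm_eq_abs, abs_mul, abs_of_pos (pow_pos hr j)]
  exact mul_le_mul_of_nonneg_right (h j) (pow_pos hr j).le

theorem summable (hc : IsEntireSeries c) (x : ℝ) : Summable fun j : ℕ => c j * x ^ j := by
  refine Summable.of_norm_bounded (hc.summable_abs (r := |x| + 1) (by positivity)) fun j => ?_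
  rw [Real.norm_eq_abs, abs_mul, abs_pow]
  gcongr
  linarith

theorem hasSum (hc : IsEntireSeries c) (x : ℝ) :
    HasSum (fun j : ℕ => c j * x ^ j) (powerSum c x) :=
  (hc.summable x).hasSum

theorem add (hc : IsEntireSeries c) (hd : IsEntireSeries d) :
    IsEntireSeries fun j => c j + d j := fun r hr => by
  simpa only [add_mul] using (hc r hr).add (hd r hr)

theorem const_mul (hc : IsEntireSeries c) (k : ℝ) : IsEntireSeries fun j => k * c j :=
  fun r hr => by simpa only [mul_assoc] using (hc r hr).mul_left k

theorem shift (hc : IsEntireSeries c) : IsEntireSeries (shiftCoeff c) := by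
  intro r hr
  refine (((summable_nat_add_iff 1).2 (hc r hr)).mul_right r⁻¹).congr fun j => ?_
  simp only [shiftCoeff]
  rw [pow_succ]
  field_simp

theorem of_shift (hc : IsEntireSeries (shiftCoeff c)) : IsEntireSeries c := by
  intro r hr
  refine (summable_nat_add_iff 1).1 (((hc r hr).mul_right r).congr fun j => ?_)
  simp only [shiftCoeff]
  ring

theorem natCast_mul (hc : IsEntireSeries c) : IsEntireSeries fun j => (j : ℝ) * c j := by
  intro r hr
  refine Summable.of_norm_bounded (hc.summable_abs (r := 2 * r) (by positivity)) fun j => ?_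
  have h : (j : ℝ) ≤ 2 ^ j := by exact_mod_cast Nat.lt_two_pow_self.le
  rw [Real.norm_eq_abs, abs_mul, abs_mul, abs_of_pos (pow_pos hr j), Nat.abs_cast, mul_pow]
  calc (j : ℝ) * |c j| * r ^ j ≤ 2 ^ j * |c j| * r ^ j := by gcongr
    _ = |c j| * (2 ^ j * r ^ j) := by ring

theorem shiftCoeff_natCast_mul (c : ℕ → ℝ) :
    shiftCoeff (fun j => (j : ℝ) * c j) = derivCoeff c := by
  funext j
  simp [shiftCoeff, derivCoeff]

theorem deriv (hc : IsEntireSeries c) : IsEntireSeries (derivCoeff c) := by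
  rw [← shiftCoeff_natCast_mul]
  exact hc.natCast_mul.shift

end IsEntireSeries

section

open IsEntireSeries

variable {c d : ℕ → ℝ}

theorem powerSum_add (hc : IsEntireSeries c) (hd : IsEntireSeries d) (x : ℝ) :
    powerSum (fun j => c j + d j) x = powerSum c x + powerSum d x := by
  refine HasSum.tsum_eq ?_
  simpa only [add_mul] using (hc.hasSum x).add (hd.hasSum x)

theorem powerSum_const_mul (k : ℝ) (c : ℕ → ℝ) (x : ℝ) :
    powerSum (fun j => k * c j) x = k * powerSum c x := by
  simp only [powerSum, mul_assoc, tsum_mul_left]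

theorem powerSum_eq_add_shift (hc : IsEntireSeries c) (x : ℝ) :
    powerSum c x = c 0 + x * powerSum (shiftCoeff c) x := by
  rw [powerSum, (hc.summable x).tsum_eq_zero_add, powerSum, ← tsum_mul_left]
  simp only [pow_zero, mul_one, shiftCoeff]
  congr 2
  funext j
  ring

theorem mul_powerSum_derivCoeff (hc : IsEntireSeries c) (x : ℝ) :
    x * powerSum (derivCoeff c) x = powerSum (fun j => (j : ℝ) * c j) x := by
  rw [powerSum_eq_add_shift hc.natCast_mul, shiftCoeff_natCast_mul]
  simp

theorem hasDerivAt_powerSum (hc : IsEntireSeries c) (x : ℝ) :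
    HasDerivAt (powerSum c) (powerSum (derivCoeff c) x) x := by
  have hR : 0 < |x| + 1 := by positivity
  have hsum : Summable fun j : ℕ => |c j| * (j * (|x| + 1) ^ (j - 1)) := by
    refine (summable_nat_add_iff 1).1 ((hc.deriv.summable_abs hR).congr fun j => ?_)
    have : |(j : ℝ) + 1| = j + 1 := abs_of_nonneg (by positivity)
    simp only [derivCoeff, abs_mul, this, Nat.add_sub_cancel]
    push_cast
    ring
  have hx : x ∈ Metric.ball (0 : ℝ) (|x| + 1) := by simp
  have hbound : ∀ (j : ℕ) (y : ℝ), y ∈ Metric.ball (0 : ℝ) (|x| + 1) →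
      ‖c j * (j * y ^ (j - 1))‖ ≤ |c j| * (j * (|x| + 1) ^ (j - 1)) := by
    intro j y hy
    have hy' : |y| ≤ |x| + 1 := by simpa using (Metric.mem_ball.1 hy).le
    rw [Real.norm_eq_abs, abs_mul, abs_mul, abs_pow, Nat.abs_cast]
    gcongr
  have h := hasDerivAt_tsum_of_isPreconnected (g := fun (j : ℕ) y => c j * y ^ j)
    (g' := fun (j : ℕ) y => c j * (j * y ^ (j - 1))) hsum Metric.isOpen_ball
    (convex_ball (0 : ℝ) _).isPreconnected
    (fun j y _ => (hasDerivAt_pow j y).const_mul (c j)) hbound hx (hc.summable x) hx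
  refine h.congr_deriv ?_
  rw [(Summable.of_norm_bounded hsum fun j => hbound j x hx).tsum_eq_zero_add, powerSum]
  simp only [Nat.cast_zero, zero_mul, mul_zero, zero_add, Nat.add_sub_cancel, derivCoeff]
  congr 1
  funext j
  push_cast
  ring

theorem tendsto_powerSum_nhdsGT_zero (hc : IsEntireSeries c) :
    Tendsto (powerSum c) (𝓝[>] 0) (𝓝 (c 0)) := by
  have h := (hasDerivAt_powerSum hc 0).continuousAt.tendsto
  rw [powerSum_eq_add_shift hc, zero_mul, add_zero] at h
  exact h.mono_left nhdsWithin_le_nhds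

/-! ### Logarithmic expansions: uniqueness and integration -/

theorem isPowerExpansion_iff_isLogPowerExpansion {f : ℝ → ℝ} :
    IsPowerExpansion f c ↔ IsLogPowerExpansion f c fun _ => 0 := by
  refine forall₂_congr fun r _ => ?_
  constructor
  · intro h
    exact ⟨h.summable, by simp, by simp [h.tsum_eq]⟩
  · rintro ⟨h, -, h'⟩
    have : f r = ∑' j, c j * r ^ j := by simpa using h'
    rw [this]
    exact h.hasSum

theorem isLogPowerExpansion_iff {f : ℝ → ℝ} {a b : ℕ → ℝ} :
    IsLogPowerExpansion f a b ↔ IsEntireSeries a ∧ IsEntireSeries b ∧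
      ∀ r, 0 < r → f r = powerSum a r + powerSum b r * Real.log r :=
  ⟨fun h => ⟨fun r hr => (h r hr).1, fun r hr => (h r hr).2.1, fun r hr => (h r hr).2.2⟩,
    fun h r hr => ⟨h.1 r hr, h.2.1 r hr, h.2.2 r hr⟩⟩

/-- Dividing by `log r` and letting `r → 0` kills `b 0`; the remaining logarithmic term is then
`O(r log r)`, so that `a 0` vanishes as well. -/
theorem coeff_zero_of_powerSum_add_log_eq_zero {a b : ℕ → ℝ} (ha : IsEntireSeries a)
    (hb : IsEntireSeries b)
    (h : ∀ r, 0 < r → powerSum a r + powerSum b r * Real.log r = 0) : a 0 = 0 ∧ b 0 = 0 := by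
  have hta := tendsto_powerSum_nhdsGT_zero ha
  have htb := tendsto_powerSum_nhdsGT_zero hb
  have hb0 : b 0 = 0 := by
    have hinv : Tendsto (fun r => -powerSum a r * (Real.log r)⁻¹) (𝓝[>] 0) (𝓝 (-a 0 * 0)) :=
      hta.neg.mul (tendsto_inv_atBot_zero.comp Real.tendsto_log_nhdsGT_zero)
    rw [mul_zero] at hinv
    refine tendsto_nhds_unique htb (hinv.congr' ?_)
    filter_upwards [Ioo_mem_nhdsGT (zero_lt_one' ℝ)] with r hr
    have hlog : Real.log r ≠ 0 := (Real.log_neg hr.1 hr.2).ne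
    have := h r hr.1
    field_simp
    linarith
  refine ⟨?_, hb0⟩
  have hlog : Tendsto (fun r => powerSum a r + powerSum (shiftCoeff b) r * (Real.log r * r))
      (𝓝[>] 0) (𝓝 (a 0 + b 1 * 0)) := by
    have := tendsto_log_mul_rpow_nhdsGT_zero (r := 1) one_pos
    simp only [Real.rpow_one] at this
    exact hta.add ((tendsto_powerSum_nhdsGT_zero hb.shift).mul this)
  rw [mul_zero, add_zero] at hlog
  refine tendsto_nhds_unique hlog (tendsto_const_nhds.congr' ?_)
  filter_upwards [self_mem_nhdsWithin] with r hr
  have := h r hr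
  rw [powerSum_eq_add_shift hb, hb0] at this
  linarith

theorem coeff_eq_zero_of_powerSum_add_log_eq_zero (j : ℕ) : ∀ {a b : ℕ → ℝ}, IsEntireSeries a →
    IsEntireSeries b → (∀ r, 0 < r → powerSum a r + powerSum b r * Real.log r = 0) →
    a j = 0 ∧ b j = 0 := by
  induction j with
  | zero => exact fun ha hb h => coeff_zero_of_powerSum_add_log_eq_zero ha hb h
  | succ j ih =>
    intro a b ha hb h
    obtain ⟨ha0, hb0⟩ := coeff_zero_of_powerSum_add_log_eq_zero ha hb h
    refine ih ha.shift hb.shift fun r hr => ?_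
    have := h r hr
    rw [powerSum_eq_add_shift ha, powerSum_eq_add_shift hb, ha0, hb0] at this
    refine (mul_eq_zero.1 (?_ : r * _ = 0)).resolve_left hr.ne'
    linear_combination this

theorem IsLogPowerExpansion.unique {f : ℝ → ℝ} {a b a' b' : ℕ → ℝ}
    (h : IsLogPowerExpansion f a b) (h' : IsLogPowerExpansion f a' b') : a = a' ∧ b = b' := by
  rw [isLogPowerExpansion_iff] at h h'
  obtain ⟨ha, hb, hf⟩ := h
  obtain ⟨ha', hb', hf'⟩ := h'
  have key : ∀ j, a j + -1 * a' j = 0 ∧ b j + -1 * b' j = 0 := fun j =>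
    coeff_eq_zero_of_powerSum_add_log_eq_zero j (ha.add (ha'.const_mul (-1)))
      (hb.add (hb'.const_mul (-1))) fun r hr => by
        rw [powerSum_add ha (ha'.const_mul _), powerSum_add hb (hb'.const_mul _),
          powerSum_const_mul, powerSum_const_mul]
        linear_combination (hf r hr).symm.trans (hf' r hr)
  exact ⟨funext fun j => by linarith [(key j).1], funext fun j => by linarith [(key j).2]⟩

/-- Logarithmic coefficients of an antiderivative of `-r * (∑ a r ^ j + ∑ b r ^ j * log r)`. -/
noncomputable def raiseLogCoeff (b : ℕ → ℝ) : ℕ → ℝ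
  | 0 => 0
  | 1 => 0
  | j + 2 => -b j / (j + 2)

/-- Non-logarithmic coefficients of the antiderivative of
`-r * (∑ a r ^ j + ∑ b r ^ j * log r)` with constant term `C`; the second summand comes from
`∫ r ^ (j + 1) * log r = r ^ (j + 2) * (log r / (j + 2) - 1 / (j + 2) ^ 2)`. -/
noncomputable def raiseCoeff (a b : ℕ → ℝ) (C : ℝ) : ℕ → ℝ
  | 0 => C
  | 1 => 0
  | j + 2 => -a j / (j + 2) + b j / (j + 2) ^ 2

theorem abs_div_natCast_add_two_le (x : ℝ) (j : ℕ) : |x / ((j : ℝ) + 2)| ≤ |x| := by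
  rw [abs_div]
  refine div_le_self (abs_nonneg x) ?_
  rw [abs_of_pos (by positivity)]
  linarith [(Nat.cast_nonneg j : (0 : ℝ) ≤ j)]

theorem IsEntireSeries.raise_log {b : ℕ → ℝ} (hb : IsEntireSeries b) :
    IsEntireSeries (raiseLogCoeff b) := by
  refine of_shift (of_shift (hb.of_abs_le fun j => ?_))
  simpa only [shiftCoeff, raiseLogCoeff, abs_neg] using abs_div_natCast_add_two_le (-b j) j

theorem IsEntireSeries.raise {a b : ℕ → ℝ} (ha : IsEntireSeries a) (hb : IsEntireSeries b)
    (C : ℝ) : IsEntireSeries (raiseCoeff a b C) := by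
  refine of_shift (of_shift (IsEntireSeries.add (ha.of_abs_le fun j => ?_)
    (hb.of_abs_le fun j => ?_)))
  · simpa only [abs_neg] using abs_div_natCast_add_two_le (-a j) j
  · have := (abs_div_natCast_add_two_le (b j / (j + 2)) j).trans
      (abs_div_natCast_add_two_le (b j) j)
    rwa [div_div, ← pow_two] at this

theorem hasDerivAt_raise {a b : ℕ → ℝ} (ha : IsEntireSeries a) (hb : IsEntireSeries b) (C : ℝ)
    {r : ℝ} (hr : 0 < r) :
    HasDerivAt (fun r => powerSum (raiseCoeff a b C) r + powerSum (raiseLogCoeff b) r * Real.log r)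
      (-r * (powerSum a r + powerSum b r * Real.log r)) r := by
  have hA := ha.raise hb C
  have hB := hb.raise_log
  have h := (hasDerivAt_powerSum hA r).add
    ((hasDerivAt_powerSum hB r).mul (Real.hasDerivAt_log hr.ne'))
  have hlog : powerSum (derivCoeff (raiseLogCoeff b)) r = -r * powerSum b r := by
    have e : shiftCoeff (derivCoeff (raiseLogCoeff b)) = fun j => -1 * b j := by
      funext j
      simp only [shiftCoeff, derivCoeff, raiseLogCoeff]
      push_cast
      have : (j : ℝ) + 2 ≠ 0 := by positivity
      field_simp
      ring
    rw [powerSum_eq_add_shift hB.deriv, e, powerSum_const_mul]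
    simp [derivCoeff, raiseLogCoeff]
  have hrest : powerSum (derivCoeff (raiseCoeff a b C)) r + powerSum (raiseLogCoeff b) r * r⁻¹ =
      -r * powerSum a r := by
    rw [powerSum_eq_add_shift hB]
    have e : shiftCoeff (fun j => derivCoeff (raiseCoeff a b C) j + shiftCoeff (raiseLogCoeff b) j) =
        fun j => -1 * a j := by
      funext j
      simp only [shiftCoeff, derivCoeff, raiseLogCoeff, raiseCoeff]
      push_cast
      have : (j : ℝ) + 2 ≠ 0 := by positivity
      field_simp
      ring
    have h2 := powerSum_eq_add_shift (hA.deriv.add hB.shift) r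
    rw [powerSum_add hA.deriv hB.shift, e, powerSum_const_mul] at h2
    have h0 : raiseLogCoeff b 0 = 0 := rfl
    have h1 : derivCoeff (raiseCoeff a b C) 0 + shiftCoeff (raiseLogCoeff b) 0 = 0 := by
      simp [derivCoeff, shiftCoeff, raiseLogCoeff, raiseCoeff]
    rw [h1] at h2
    rw [h0]
    field_simp
    linear_combination r * h2
  refine h.congr_deriv ?_
  rw [hlog]
  linear_combination hrest

/-- Two functions with the same derivative on the positive half-line differ by a constant there. -/
theorem exists_eq_add_const_of_hasDerivAt {f g f' : ℝ → ℝ}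
    (hf : ∀ r, 0 < r → HasDerivAt f (f' r) r) (hg : ∀ r, 0 < r → HasDerivAt g (f' r) r) :
    ∃ C, ∀ r, 0 < r → f r = g r + C := by
  have hfg : ∀ r, 0 < r → HasDerivAt (f - g) 0 r := fun r hr => by
    simpa using (hf r hr).sub (hg r hr)
  obtain ⟨C, hC⟩ := isOpen_Ioi.exists_is_const_of_deriv_eq_zero
    (convex_Ioi (0 : ℝ)).isPreconnected (f := f - g)
    (fun r hr => (hfg r hr).differentiableAt.differentiableWithinAt)
    (fun r hr => (hfg r hr).deriv)
  refine ⟨C, fun r hr => ?_⟩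
  have := hC r hr
  simp only [Pi.sub_apply] at this
  linarith

theorem IsLogPowerExpansion.raise {f g : ℝ → ℝ} {a b : ℕ → ℝ} (h : IsLogPowerExpansion f a b)
    (hg : ∀ r, 0 < r → HasDerivAt g (-r * f r) r) :
    ∃ C, IsLogPowerExpansion g (raiseCoeff a b C) (raiseLogCoeff b) := by
  rw [isLogPowerExpansion_iff] at h
  obtain ⟨ha, hb, hf⟩ := h
  obtain ⟨C, hC⟩ := exists_eq_add_const_of_hasDerivAt hg (fun r hr => by
    rw [hf r hr]
    exact hasDerivAt_raise ha hb 0 hr)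
  refine ⟨C, isLogPowerExpansion_iff.2 ⟨ha.raise hb C, hb.raise_log, fun r hr => ?_⟩⟩
  have e : shiftCoeff (raiseCoeff a b C) = shiftCoeff (raiseCoeff a b 0) := by
    funext j
    cases j <;> rfl
  rw [hC r hr, powerSum_eq_add_shift (ha.raise hb C), e,
    powerSum_eq_add_shift (ha.raise hb 0)]
  simp only [raiseCoeff]
  ring

end

/-! ### Decay of the Bessel integrands -/

theorem sq_div_four_le_cosh (t : ℝ) : t ^ 2 / 4 ≤ Real.cosh t := by
  rw [← Real.cosh_abs, Real.cosh_eq, ← sq_abs]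
  have h1 := Real.quadratic_le_exp_of_nonneg (abs_nonneg t)
  have h2 := Real.exp_pos (-|t|)
  linarith [abs_nonneg t]

theorem cosh_le_exp_abs (t : ℝ) : Real.cosh t ≤ Real.exp |t| := by
  rw [← Real.cosh_abs, Real.cosh_eq]
  have : Real.exp (-|t|) ≤ Real.exp |t| := Real.exp_le_exp.2 (by linarith [abs_nonneg t])
  linarith

theorem abs_sinh_le_exp_abs (t : ℝ) : |Real.sinh t| ≤ Real.exp |t| := by
  rw [Real.abs_sinh]
  exact (Real.sinh_lt_cosh _).le.trans (by simpa using cosh_le_exp_abs |t|)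

/-- A factor of exponential growth is absorbed by `exp (-x * cosh t)`, by completing the square
in `-x * t ^ 2 / 4 + M * |t|`. -/
theorem exp_neg_mul_cosh_mul_exp_le {x : ℝ} (hx : 0 < x) (M t : ℝ) :
    Real.exp (-x * Real.cosh t) * Real.exp (M * |t|) ≤
      Real.exp (2 * M ^ 2 / x) * Real.exp (-(x / 8) * t ^ 2) := by
  rw [← Real.exp_add, ← Real.exp_add, Real.exp_le_exp]
  have h1 : x * (t ^ 2 / 4) ≤ x * Real.cosh t :=
    mul_le_mul_of_nonneg_left (sq_div_four_le_cosh t) hx.le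
  have h2 : 0 ≤ x / 8 * (|t| - 4 * M / x) ^ 2 := by positivity
  have h3 : x / 8 * (|t| - 4 * M / x) ^ 2 = x / 8 * t ^ 2 - M * |t| + 2 * M ^ 2 / x := by
    rw [← sq_abs t]
    field_simp
    ring
  linarith

theorem integrable_exp_neg_mul_cosh_mul {x M : ℝ} (hx : 0 < x) {g : ℝ → ℝ} (hg : Continuous g)
    (hgM : ∀ t, |g t| ≤ Real.exp (M * |t|)) :
    Integrable fun t => Real.exp (-x * Real.cosh t) * g t := by
  refine ((integrable_exp_neg_mul_sq (b := x / 8) (by positivity)).const_mul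
    (Real.exp (2 * M ^ 2 / x))).mono' (by fun_prop) (Eventually.of_forall fun t => ?_)
  rw [Real.norm_eq_abs, abs_mul, Real.abs_exp]
  exact (mul_le_mul_of_nonneg_left (hgM t) (Real.exp_pos _).le).trans
    (exp_neg_mul_cosh_mul_exp_le hx M t)

theorem tendsto_exp_neg_mul_cosh_mul {x M : ℝ} (hx : 0 < x) {g : ℝ → ℝ}
    (hgM : ∀ t, |g t| ≤ Real.exp (M * |t|)) :
    Tendsto (fun t => Real.exp (-x * Real.cosh t) * g t) atTop (𝓝 0) := by
  have h : Tendsto (fun t : ℝ => Real.exp (2 * M ^ 2 / x) * Real.exp (-(x / 8) * t ^ 2)) atTop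
      (𝓝 (Real.exp (2 * M ^ 2 / x) * 0)) := by
    refine (Real.tendsto_exp_atBot.comp ?_).const_mul _
    exact (tendsto_pow_atTop two_ne_zero).const_mul_atTop_of_neg (by linarith)
  rw [mul_zero] at h
  refine squeeze_zero_norm (fun t => ?_) h
  rw [Real.norm_eq_abs, abs_mul, Real.abs_exp]
  exact (mul_le_mul_of_nonneg_left (hgM t) (Real.exp_pos _).le).trans
    (exp_neg_mul_cosh_mul_exp_le hx M t)

theorem cosh_mul_le_exp (ν t : ℝ) : |Real.cosh (ν * t)| ≤ Real.exp (|ν| * |t|) := by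
  rw [abs_of_pos (Real.cosh_pos _), ← abs_mul]
  exact cosh_le_exp_abs _

theorem abs_cosh_mul_cosh_le_exp (ν t : ℝ) :
    |Real.cosh t * Real.cosh (ν * t)| ≤ Real.exp ((1 + |ν|) * |t|) := by
  rw [abs_mul, add_mul, Real.exp_add]
  gcongr
  · simpa using cosh_mul_le_exp 1 t
  · exact cosh_mul_le_exp ν t

theorem abs_sinh_mul_sinh_le_exp (ν t : ℝ) :
    |Real.sinh t * Real.sinh (ν * t)| ≤ Real.exp ((1 + |ν|) * |t|) := by
  rw [abs_mul, add_mul, Real.exp_add, one_mul, ← abs_mul ν]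
  gcongr <;> exact abs_sinh_le_exp_abs _

/-! ### Derivatives of Bessel functions -/

theorem hasDerivAt_besselK (ν : ℝ) {x : ℝ} (hx : 0 < x) :
    HasDerivAt (besselK ν)
      (-∫ t in Ioi (0 : ℝ), Real.exp (-x * Real.cosh t) * (Real.cosh t * Real.cosh (ν * t))) x := by
  have hx2 : 0 < x / 2 := by positivity
  have h := (hasDerivAt_integral_of_dominated_loc_of_deriv_le (μ := volume.restrict (Ioi (0 : ℝ)))
    (F := fun x t => Real.exp (-x * Real.cosh t) * Real.cosh (ν * t))
    (F' := fun x t => -(Real.exp (-x * Real.cosh t) * (Real.cosh t * Real.cosh (ν * t))))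
    (bound := fun t => Real.exp (-(x / 2) * Real.cosh t) * |Real.cosh t * Real.cosh (ν * t)|)
    (x₀ := x) (s := Ioi (x / 2)) (Ioi_mem_nhds (by linarith))
    (Eventually.of_forall fun y => Continuous.aestronglyMeasurable (by fun_prop))
    (integrable_exp_neg_mul_cosh_mul hx (by fun_prop) (cosh_mul_le_exp ν)).integrableOn
    (Continuous.aestronglyMeasurable (by fun_prop))
    (Eventually.of_forall fun t y hy => ?_)
    (integrable_exp_neg_mul_cosh_mul hx2 (by fun_prop)
      (fun t => by rw [abs_abs]; exact abs_cosh_mul_cosh_le_exp ν t)).integrableOn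
    (Eventually.of_forall fun t y _ => ?_)).2
  · rwa [integral_neg] at h
  · rw [norm_neg, Real.norm_eq_abs, abs_mul, Real.abs_exp]
    have : x / 2 ≤ y := (mem_Ioi.1 hy).le
    gcongr
  · have := (((hasDerivAt_id y).neg.mul_const (Real.cosh t)).exp).mul_const (Real.cosh (ν * t))
    refine this.congr_deriv ?_
    simp only [id, Pi.neg_apply]
    ring

theorem hasDerivAt_besselK_zero {x : ℝ} (hx : 0 < x) :
    HasDerivAt (besselK 0) (-besselK 1 x) x := by
  simpa [besselK] using hasDerivAt_besselK 0 hx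

/-- Integration by parts: `exp (-x * cosh t) * sinh (μ * t)` vanishes at both ends. -/
theorem mul_besselK_eq_integral_sinh (μ : ℝ) {x : ℝ} (hx : 0 < x) :
    μ * besselK μ x =
      x * ∫ t in Ioi (0 : ℝ), Real.exp (-x * Real.cosh t) * (Real.sinh t * Real.sinh (μ * t)) := by
  have hc : IntegrableOn (fun t => Real.exp (-x * Real.cosh t) * Real.cosh (μ * t)) (Ioi 0) :=
    (integrable_exp_neg_mul_cosh_mul hx (by fun_prop) (cosh_mul_le_exp μ)).integrableOn
  have hs : IntegrableOn
      (fun t => Real.exp (-x * Real.cosh t) * (Real.sinh t * Real.sinh (μ * t))) (Ioi 0) :=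
    (integrable_exp_neg_mul_cosh_mul hx (by fun_prop) (abs_sinh_mul_sinh_le_exp μ)).integrableOn
  have h := integral_Ioi_of_hasDerivAt_of_tendsto' (a := (0 : ℝ)) (m := 0)
    (f := fun t => Real.exp (-x * Real.cosh t) * Real.sinh (μ * t))
    (f' := fun t => μ * (Real.exp (-x * Real.cosh t) * Real.cosh (μ * t)) -
      x * (Real.exp (-x * Real.cosh t) * (Real.sinh t * Real.sinh (μ * t))))
    (fun t _ => ?_) ((hc.const_mul μ).sub (hs.const_mul x))
    (tendsto_exp_neg_mul_cosh_mul (M := |μ|) hx fun t => by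
      rw [← abs_mul]; exact abs_sinh_le_exp_abs _)
  · rw [integral_sub (hc.const_mul μ) (hs.const_mul x), integral_const_mul,
      integral_const_mul] at h
    simp only [mul_zero, Real.sinh_zero, sub_zero] at h
    rw [besselK]
    linarith
  · have h1 := ((Real.hasDerivAt_cosh t).const_mul (-x)).exp.mul
      ((Real.hasDerivAt_sinh (μ * t)).comp t ((hasDerivAt_id t).const_mul μ))
    refine h1.congr_deriv ?_
    simp only [Function.comp]
    ring

/-- Each `K_{ν+1}(r) r ^ (ν+1)` is an antiderivative of `-r` times its predecessor. -/
theorem hasDerivAt_besselK_mul_rpow (ν : ℝ) {r : ℝ} (hr : 0 < r) :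
    HasDerivAt (fun r => besselK (ν + 1) r * r ^ (ν + 1)) (-r * (besselK ν r * r ^ ν)) r := by
  have hc := (integrable_exp_neg_mul_cosh_mul hr (by fun_prop)
    (abs_cosh_mul_cosh_le_exp (ν + 1))).integrableOn (s := Ioi 0)
  have hs := (integrable_exp_neg_mul_cosh_mul hr (by fun_prop)
    (abs_sinh_mul_sinh_le_exp (ν + 1))).integrableOn (s := Ioi 0)
  have hK : besselK ν r =
      (∫ t in Ioi (0 : ℝ), Real.exp (-r * Real.cosh t) *
        (Real.cosh t * Real.cosh ((ν + 1) * t))) -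
      ∫ t in Ioi (0 : ℝ), Real.exp (-r * Real.cosh t) *
        (Real.sinh t * Real.sinh ((ν + 1) * t)) := by
    rw [← integral_sub hc hs, besselK]
    congr 1
    funext t
    have : ν * t = (ν + 1) * t - t := by ring
    rw [this, Real.cosh_sub]
    ring
  have h := (hasDerivAt_besselK (ν + 1) hr).mul
    (Real.hasDerivAt_rpow_const (p := ν + 1) (Or.inl hr.ne'))
  refine h.congr_deriv ?_
  have hp := mul_besselK_eq_integral_sinh (ν + 1) hr
  rw [hK, add_sub_cancel_right, Real.rpow_add hr, Real.rpow_one]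
  linear_combination r ^ ν * hp

/-! ### The function of order one half -/

/-- The substitution `u = sinh (t / 2)`, with `cosh t = 1 + 2 * u ^ 2`, gives a Gaussian integral. -/
theorem besselK_one_half {x : ℝ} (hx : 0 < x) :
    besselK (1 / 2) x = Real.sqrt (Real.pi / (2 * x)) * Real.exp (-x) := by
  have hpt : ∀ t : ℝ, Real.exp (-x * Real.cosh t) * Real.cosh (1 / 2 * t) =
      ((fun u => 2 * Real.exp (-x) * Real.exp (-(2 * x) * u ^ 2)) ∘ fun t => Real.sinh (t / 2)) t *
        (Real.cosh (t / 2) / 2) := by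
    intro t
    have hcosh : Real.cosh t = 1 + 2 * Real.sinh (t / 2) ^ 2 := by
      have h := Real.cosh_two_mul (t / 2)
      rw [Real.cosh_sq, mul_div_cancel₀ t two_ne_zero] at h
      linarith
    have he : -x * Real.cosh t = -x + -(2 * x) * Real.sinh (t / 2) ^ 2 := by
      rw [hcosh]
      ring
    simp only [Function.comp]
    rw [he, Real.exp_add, show 1 / 2 * t = t / 2 by ring]
    ring
  have hint := (integrable_exp_neg_mul_cosh_mul hx (by fun_prop)
    (cosh_mul_le_exp (1 / 2))).integrableOn (s := Ici 0)
  simp only [hpt] at hint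
  have htend : Tendsto (fun t : ℝ => Real.sinh (t / 2)) atTop atTop := by
    refine tendsto_atTop_mono' atTop ?_ (tendsto_id.atTop_div_const (zero_lt_two' ℝ))
    filter_upwards [eventually_ge_atTop 0] with t ht
    exact Real.self_le_sinh_iff.2 (by simpa using by positivity)
  rw [besselK]
  simp only [hpt]
  rw [integral_comp_mul_deriv_Ioi (by fun_prop) htend (fun t _ => ?_) (by fun_prop)
    (((integrable_exp_neg_mul_sq (by positivity)).const_mul _).integrableOn) hint]
  · rw [integral_const_mul, zero_div, Real.sinh_zero, integral_gaussian_Ioi]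
    ring
  · have := (Real.hasDerivAt_sinh (t / 2)).comp t ((hasDerivAt_id t).div_const 2)
    refine (this.congr_deriv ?_).hasDerivWithinAt
    ring

theorem sqrt_two_div_pi_mul_besselK_one_half {r : ℝ} (hr : 0 < r) :
    Real.sqrt (2 / Real.pi) * besselK (1 / 2) r * r ^ (1 / 2 : ℝ) = Real.exp (-r) := by
  have hpi := Real.pi_pos
  rw [besselK_one_half hr, ← Real.sqrt_eq_rpow]
  have : Real.sqrt (2 / Real.pi) * Real.sqrt (Real.pi / (2 * r)) * Real.sqrt r = 1 := by
    rw [← Real.sqrt_mul (by positivity), ← Real.sqrt_mul (by positivity)]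
    rw [show 2 / Real.pi * (Real.pi / (2 * r)) * r = 1 by field_simp, Real.sqrt_one]
  linear_combination Real.exp (-r) * this

/-! ### The function of order one near zero -/

theorem integral_exp_neg_mul_sinh_mul_cosh {x : ℝ} (hx : 0 < x) :
    IntegrableOn (fun t => Real.exp (-x * Real.sinh t) * Real.cosh t) (Ioi 0) ∧
      x * ∫ t in Ioi (0 : ℝ), Real.exp (-x * Real.sinh t) * Real.cosh t = 1 := by
  have htend : Tendsto (fun t => -(Real.exp (-x * Real.sinh t) / x)) atTop (𝓝 (-(0 / x))) := by
    refine ((Real.tendsto_exp_atBot.comp ?_).div_const x).neg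
    refine Tendsto.const_mul_atTop_of_neg (by linarith) ?_
    refine tendsto_atTop_mono' atTop ?_ tendsto_id
    filter_upwards [eventually_ge_atTop 0] with t ht
    exact Real.self_le_sinh_iff.2 ht
  have hderiv : ∀ t ∈ Ici (0 : ℝ), HasDerivAt (fun t => -(Real.exp (-x * Real.sinh t) / x))
      (Real.exp (-x * Real.sinh t) * Real.cosh t) t := by
    intro t _
    refine ((((Real.hasDerivAt_sinh t).const_mul (-x)).exp.div_const x).neg).congr_deriv ?_
    field_simp
  have hpos : ∀ t ∈ Ioi (0 : ℝ), 0 ≤ Real.exp (-x * Real.sinh t) * Real.cosh t := fun t _ =>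
    mul_nonneg (Real.exp_pos _).le (Real.cosh_pos t).le
  have hint := integrableOn_Ioi_deriv_of_nonneg' hderiv hpos htend
  refine ⟨hint, ?_⟩
  rw [integral_Ioi_of_hasDerivAt_of_tendsto' hderiv hint htend]
  simp
  field_simp

theorem mul_besselK_one_le_one {x : ℝ} (hx : 0 < x) : x * besselK 1 x ≤ 1 := by
  obtain ⟨hint, h1⟩ := integral_exp_neg_mul_sinh_mul_cosh hx
  refine le_of_le_of_eq ?_ h1
  rw [besselK]
  refine mul_le_mul_of_nonneg_left (setIntegral_mono_on ?_ hint measurableSet_Ioi fun t _ => ?_)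
    hx.le
  · exact (integrable_exp_neg_mul_cosh_mul hx (by fun_prop) (cosh_mul_le_exp 1)).integrableOn
  · rw [one_mul]
    refine mul_le_mul_of_nonneg_right (Real.exp_le_exp.2 ?_) (Real.cosh_pos t).le
    nlinarith [(Real.sinh_lt_cosh t).le]

theorem exp_neg_le_mul_besselK_one {x : ℝ} (hx : 0 < x) : Real.exp (-x) ≤ x * besselK 1 x := by
  obtain ⟨hint, h1⟩ := integral_exp_neg_mul_sinh_mul_cosh hx
  have h2 : Real.exp (-x) = x * ∫ t in Ioi (0 : ℝ),
      Real.exp (-x) * (Real.exp (-x * Real.sinh t) * Real.cosh t) := by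
    rw [integral_const_mul]
    linear_combination -Real.exp (-x) * h1
  rw [h2, besselK]
  refine mul_le_mul_of_nonneg_left (setIntegral_mono_on (hint.const_mul _) ?_ measurableSet_Ioi
    fun t ht => ?_) hx.le
  · exact (integrable_exp_neg_mul_cosh_mul hx (by fun_prop) (cosh_mul_le_exp 1)).integrableOn
  · rw [one_mul, ← mul_assoc, ← Real.exp_add]
    refine mul_le_mul_of_nonneg_right (Real.exp_le_exp.2 ?_) (Real.cosh_pos t).le
    have h3 : Real.cosh t - Real.sinh t ≤ 1 := by
      rw [Real.cosh_sub_sinh]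
      exact Real.exp_le_one_iff.2 (by linarith [mem_Ioi.1 ht])
    nlinarith

theorem tendsto_mul_besselK_one : Tendsto (fun x => x * besselK 1 x) (𝓝[>] 0) (𝓝 1) := by
  have h : Tendsto (fun x : ℝ => Real.exp (-x)) (𝓝[>] 0) (𝓝 1) := by
    have : Tendsto (fun x : ℝ => Real.exp (-x)) (𝓝 0) (𝓝 (Real.exp (-0))) :=
      (Continuous.tendsto (by fun_prop) 0)
    rw [neg_zero, Real.exp_zero] at this
    exact this.mono_left nhdsWithin_le_nhds
  refine tendsto_of_tendsto_of_tendsto_of_le_of_le' h tendsto_const_nhds ?_ ?_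
  · filter_upwards [self_mem_nhdsWithin] with x hx using exp_neg_le_mul_besselK_one hx
  · filter_upwards [self_mem_nhdsWithin] with x hx using mul_besselK_one_le_one hx

theorem besselK_nonneg (ν x : ℝ) : 0 ≤ besselK ν x :=
  integral_nonneg fun _ => mul_nonneg (Real.exp_pos _).le (Real.cosh_pos _).le

theorem besselK_zero_le_besselK_one {x : ℝ} (hx : 0 < x) : besselK 0 x ≤ besselK 1 x := by
  refine integral_mono
    (integrable_exp_neg_mul_cosh_mul hx (by fun_prop) (cosh_mul_le_exp 0)).integrableOn
    (integrable_exp_neg_mul_cosh_mul hx (by fun_prop) (cosh_mul_le_exp 1)).integrableOn fun t => ?_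
  refine mul_le_mul_of_nonneg_left ?_ (Real.exp_pos _).le
  simp

/-! ### The function of order zero -/

/-- `p` and `q = x * p'` satisfy the first order system equivalent to the modified Bessel equation
`(x * p')' = x * p` of order zero on the positive half-line. -/
def IsBesselPair (p q : ℝ → ℝ) : Prop :=
  ∀ x : ℝ, 0 < x → HasDerivAt p (q x / x) x ∧ HasDerivAt q (x * p x) x

/-- The Wronskian of two solutions, multiplied by `x`, is constant. -/
theorem IsBesselPair.exists_wronskian_eq {p q p' q' : ℝ → ℝ} (h : IsBesselPair p q)
    (h' : IsBesselPair p' q') : ∃ C, ∀ x, 0 < x → p x * q' x - q x * p' x = C := by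
  obtain ⟨C, hC⟩ := exists_eq_add_const_of_hasDerivAt (f := fun x => p x * q' x - q x * p' x)
    (g := fun _ => 0) (f' := fun _ => 0) (fun x hx => by
    refine (((h x hx).1.mul (h' x hx).2).sub ((h x hx).2.mul (h' x hx).1)).congr_deriv ?_
    ring) (fun x _ => hasDerivAt_const x 0)
  exact ⟨C, fun x hx => by simpa using hC x hx⟩

/-- The Wronskian may be evaluated as a limit at zero. -/
theorem IsBesselPair.wronskian_eq_of_tendsto {p q p' q' : ℝ → ℝ} {L : ℝ} (h : IsBesselPair p q)
    (h' : IsBesselPair p' q')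
    (hL : Tendsto (fun x => p x * q' x - q x * p' x) (𝓝[>] 0) (𝓝 L)) {x : ℝ} (hx : 0 < x) :
    p x * q' x - q x * p' x = L := by
  obtain ⟨C, hC⟩ := h.exists_wronskian_eq h'
  rw [hC x hx]
  refine tendsto_nhds_unique (tendsto_const_nhds.congr' ?_) hL
  filter_upwards [self_mem_nhdsWithin] with y hy using (hC y hy).symm

theorem isBesselPair_besselK : IsBesselPair (besselK 0) fun x => -(x * besselK 1 x) := by
  intro x hx
  refine ⟨(hasDerivAt_besselK_zero hx).congr_deriv (by field_simp), ?_⟩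
  have h := (hasDerivAt_besselK_mul_rpow 0 hx).neg
  simp only [zero_add, Real.rpow_one, Real.rpow_zero, mul_one] at h
  refine (h.congr_deriv (by ring)).congr_of_eventuallyEq (Eventually.of_forall fun y => ?_)
  simp [mul_comm]

/-- Power series coefficients of the modified Bessel function `I₀`. -/
noncomputable def besselICoeff : ℕ → ℝ
  | 0 => 1
  | 1 => 0
  | j + 2 => besselICoeff j / (j + 2) ^ 2

/-- Coefficients of the power series `S` for which `I₀ * log + S` solves the modified Bessel
equation of order zero. -/
noncomputable def besselLogCoeff : ℕ → ℝ
  | 0 => 0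
  | 1 => 0
  | j + 2 => (besselLogCoeff j - 2 * (j + 2) * besselICoeff (j + 2)) / (j + 2) ^ 2

theorem isEntireSeries_const_div_factorial (k : ℝ) :
    IsEntireSeries fun j => k * ((j.factorial : ℝ))⁻¹ := by
  refine IsEntireSeries.const_mul (fun r _ => ?_) k
  exact (Real.summable_pow_div_factorial r).congr fun j => by ring

theorem abs_besselICoeff_le : ∀ j : ℕ, |besselICoeff j| ≤ ((j.factorial : ℝ))⁻¹
  | 0 => by simp [besselICoeff]
  | 1 => by simp [besselICoeff]
  | j + 2 => by
    have ih := abs_besselICoeff_le j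
    have hj : (0 : ℝ) ≤ j := Nat.cast_nonneg j
    have hf : (0 : ℝ) < j.factorial := by exact_mod_cast j.factorial_pos
    rw [besselICoeff, abs_div, abs_of_pos (by positivity : (0 : ℝ) < ((j : ℝ) + 2) ^ 2),
      Nat.factorial_succ, Nat.factorial_succ]
    push_cast
    calc |besselICoeff j| / ((j : ℝ) + 2) ^ 2 ≤ ((j.factorial : ℝ))⁻¹ / ((j : ℝ) + 2) ^ 2 := by
          gcongr
      _ = (((j : ℝ) + 2) ^ 2 * j.factorial)⁻¹ := by field_simp
      _ ≤ _ := by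
          refine inv_anti₀ (by positivity) ?_
          rw [← mul_assoc]
          gcongr
          nlinarith

theorem abs_besselLogCoeff_le : ∀ j : ℕ, |besselLogCoeff j| ≤ 2 * ((j.factorial : ℝ))⁻¹
  | 0 => by simp [besselLogCoeff]
  | 1 => by simp [besselLogCoeff]
  | j + 2 => by
    have ih := abs_besselLogCoeff_le j
    have hI := abs_besselICoeff_le (j + 2)
    have hf : (0 : ℝ) < j.factorial := by exact_mod_cast j.factorial_pos
    have h2 : (0 : ℝ) < (j : ℝ) + 2 := by positivity
    have hfac : ((j + 2).factorial : ℝ) = (j + 2) * ((j + 1) * j.factorial) := by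
      rw [Nat.factorial_succ, Nat.factorial_succ]
      push_cast
      ring
    rw [besselLogCoeff, abs_div, abs_of_pos (by positivity : (0 : ℝ) < ((j : ℝ) + 2) ^ 2),
      div_le_iff₀ (by positivity)]
    calc |besselLogCoeff j - 2 * (j + 2) * besselICoeff (j + 2)|
        ≤ |besselLogCoeff j| + 2 * (j + 2) * |besselICoeff (j + 2)| := by
          refine (abs_sub _ _).trans_eq ?_
          rw [abs_mul, abs_of_pos (by positivity : (0 : ℝ) < 2 * ((j : ℝ) + 2))]
      _ ≤ 2 * ((j.factorial : ℝ))⁻¹ + 2 * (j + 2) * (((j + 2).factorial : ℝ))⁻¹ := by gcongr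
      _ = 2 * (((j + 2).factorial : ℝ))⁻¹ * (j + 2) ^ 2 := by
          rw [hfac]
          field_simp
          ring

theorem isEntireSeries_besselICoeff : IsEntireSeries besselICoeff :=
  (isEntireSeries_const_div_factorial 1).of_abs_le fun j => by
    rw [one_mul]
    exact (abs_besselICoeff_le j).trans (le_abs_self _)

theorem isEntireSeries_besselLogCoeff : IsEntireSeries besselLogCoeff :=
  (isEntireSeries_const_div_factorial 2).of_abs_le fun j =>
    (abs_besselLogCoeff_le j).trans (le_abs_self _)

theorem powerSum_derivCoeff_eq_div {c : ℕ → ℝ} (hc : IsEntireSeries c) {x : ℝ} (hx : 0 < x) :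
    powerSum (derivCoeff c) x = powerSum (fun j => (j : ℝ) * c j) x / x := by
  rw [← mul_powerSum_derivCoeff hc]
  field_simp

theorem isBesselPair_powerSum : IsBesselPair (powerSum besselICoeff)
    (powerSum fun j => (j : ℝ) * besselICoeff j) := by
  intro x hx
  have hu := isEntireSeries_besselICoeff
  refine ⟨(hasDerivAt_powerSum hu x).congr_deriv (powerSum_derivCoeff_eq_div hu hx),
    (hasDerivAt_powerSum hu.natCast_mul x).congr_deriv ?_⟩
  have e : shiftCoeff (derivCoeff fun j => (j : ℝ) * besselICoeff j) = besselICoeff := by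
    funext j
    simp only [shiftCoeff, derivCoeff, besselICoeff]
    push_cast
    field_simp
    ring
  rw [powerSum_eq_add_shift hu.natCast_mul.deriv, e]
  simp [derivCoeff, besselICoeff]

theorem isBesselPair_log : IsBesselPair
    (fun x => powerSum besselICoeff x * Real.log x + powerSum besselLogCoeff x)
    (fun x => powerSum (fun j => (j : ℝ) * besselICoeff j) x * Real.log x +
      powerSum besselICoeff x + powerSum (fun j => (j : ℝ) * besselLogCoeff j) x) := by
  intro x hx
  have hu := isEntireSeries_besselICoeff
  have hs := isEntireSeries_besselLogCoeff
  obtain ⟨h1, h2⟩ := isBesselPair_powerSum x hx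
  have hlog := Real.hasDerivAt_log hx.ne'
  constructor
  · refine ((h1.mul hlog).add (hasDerivAt_powerSum hs x)).congr_deriv ?_
    rw [powerSum_derivCoeff_eq_div hs hx]
    ring
  · refine (((h2.mul hlog).add h1).add (hasDerivAt_powerSum hs.natCast_mul x)).congr_deriv ?_
    have hd : IsEntireSeries fun j => 2 * derivCoeff besselICoeff j := hu.deriv.const_mul 2
    have e : shiftCoeff (fun j => derivCoeff (fun j => (j : ℝ) * besselLogCoeff j) j +
        2 * derivCoeff besselICoeff j) = besselLogCoeff := by
      funext j
      simp only [shiftCoeff, derivCoeff, besselLogCoeff]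
      push_cast
      field_simp
      ring
    have h3 := powerSum_eq_add_shift (hs.natCast_mul.deriv.add hd) x
    rw [powerSum_add hs.natCast_mul.deriv hd, e, powerSum_const_mul,
      powerSum_derivCoeff_eq_div hu hx] at h3
    have h0 : derivCoeff (fun j => (j : ℝ) * besselLogCoeff j) 0 +
        2 * derivCoeff besselICoeff 0 = 0 := by
      simp [derivCoeff, besselLogCoeff, besselICoeff]
    rw [h0] at h3
    linear_combination h3

/-- By Cramer's rule `K₀` is a combination of `I₀` and the logarithmic solution. The coefficient of
the latter is a Wronskian, whose limit at zero is that of `x * K₀'(x) = -x * K₁(x)`. -/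
theorem exists_besselK_zero_eq : ∃ α : ℝ, ∀ x, 0 < x → besselK 0 x =
    α * powerSum besselICoeff x -
      (powerSum besselICoeff x * Real.log x + powerSum besselLogCoeff x) := by
  have hu := isEntireSeries_besselICoeff
  have hs := isEntireSeries_besselLogCoeff
  have tu := tendsto_powerSum_nhdsGT_zero hu
  have ts := tendsto_powerSum_nhdsGT_zero hs
  have tqu := tendsto_powerSum_nhdsGT_zero hu.natCast_mul
  have tqs := tendsto_powerSum_nhdsGT_zero hs.natCast_mul
  simp only [besselICoeff, besselLogCoeff, Nat.cast_zero, zero_mul] at tu ts tqu tqs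
  have hW := fun (x : ℝ) (hx : 0 < x) =>
    isBesselPair_powerSum.wronskian_eq_of_tendsto isBesselPair_log (L := 1) (by
      have h := ((tu.mul tu).add (tu.mul tqs)).sub (tqu.mul ts)
      simp only [mul_one, mul_zero, add_zero, sub_zero] at h
      refine h.congr fun x => ?_
      ring) hx
  have hK := fun (x : ℝ) (hx : 0 < x) =>
    isBesselPair_powerSum.wronskian_eq_of_tendsto isBesselPair_besselK (L := -1) (by
      have tq : Tendsto (fun x => powerSum (derivCoeff besselICoeff) x * (x * besselK 0 x))
          (𝓝[>] 0) (𝓝 0) := by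
        have td := tendsto_powerSum_nhdsGT_zero hu.deriv
        simp only [derivCoeff, besselICoeff, mul_zero] at td
        refine td.zero_mul_isBoundedUnder_le (isBoundedUnder_of_eventually_le (a := 1) ?_)
        filter_upwards [self_mem_nhdsWithin] with x hx
        have hx : 0 < x := hx
        simp only [Function.comp, Real.norm_eq_abs]
        rw [abs_of_nonneg (mul_nonneg hx.le (besselK_nonneg 0 x))]
        exact (mul_le_mul_of_nonneg_left (besselK_zero_le_besselK_one hx) hx.le).trans
          (mul_besselK_one_le_one hx)
      have h := (tu.mul tendsto_mul_besselK_one.neg).sub tq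
      rw [one_mul, sub_zero] at h
      refine h.congr fun x => ?_
      rw [← mul_powerSum_derivCoeff hu]
      ring) hx
  obtain ⟨α, hα⟩ := isBesselPair_besselK.exists_wronskian_eq isBesselPair_log
  refine ⟨α, fun x hx => ?_⟩
  have h1 := hW x hx
  have h2 := hK x hx
  have h3 := hα x hx
  linear_combination -besselK 0 x * h1 + powerSum besselICoeff x * h3 +
    (powerSum besselICoeff x * Real.log x + powerSum besselLogCoeff x) * h2

theorem exists_isLogPowerExpansion_besselK_zero :
    ∃ a b : ℕ → ℝ, IsLogPowerExpansion (besselK 0) a b ∧ b 0 = -1 := by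
  have hu := isEntireSeries_besselICoeff
  have hs := isEntireSeries_besselLogCoeff
  obtain ⟨α, hα⟩ := exists_besselK_zero_eq
  refine ⟨fun j => α * besselICoeff j + -1 * besselLogCoeff j, fun j => -1 * besselICoeff j,
    isLogPowerExpansion_iff.2 ⟨(hu.const_mul α).add (hs.const_mul (-1)), hu.const_mul (-1),
      fun x hx => ?_⟩, by simp [besselICoeff]⟩
  rw [powerSum_add (hu.const_mul α) (hs.const_mul (-1)), powerSum_const_mul, powerSum_const_mul,
    powerSum_const_mul, hα x hx]
  ring

/-! ### Induction on the order -/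

theorem raiseLogCoeff_zero : raiseLogCoeff (fun _ => 0) = fun _ => 0 := by
  funext j
  match j with
  | 0 => rfl
  | 1 => rfl
  | j + 2 => simp [raiseLogCoeff]

theorem IsFirstNonEvenPower.raise {c : ℕ → ℝ} {m : ℕ} {A : ℝ} (h : IsFirstNonEvenPower c m A)
    (C : ℝ) :
    IsFirstNonEvenPower (raiseCoeff c (fun _ => 0) C) (m + 2) (-A / (m + 2)) := by
  obtain ⟨hm, hA, hcm, hc⟩ := h
  refine ⟨hm.add_even even_two, div_ne_zero (neg_ne_zero.2 hA) (by positivity), ?_, ?_⟩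
  · simp [raiseCoeff, hcm]
  · intro j hj hodd
    match j with
    | 0 => simp at hodd
    | 1 => rfl
    | j + 2 => simp [raiseCoeff, hc j (by omega) (by simpa [Nat.odd_add] using hodd)]

theorem IsFirstNonEvenLog.raise {a b : ℕ → ℝ} {m : ℕ} {A : ℝ} (hm : Even m)
    (h : IsFirstNonEvenLog a b m A) (C : ℝ) :
    IsFirstNonEvenLog (raiseCoeff a b C) (raiseLogCoeff b) (m + 2) (-A / (m + 2)) := by
  obtain ⟨hA, hbm, hb, ha⟩ := h
  refine ⟨div_ne_zero (neg_ne_zero.2 hA) (by positivity), by simp [raiseLogCoeff, hbm], ?_, ?_⟩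
  · intro j hj
    match j with
    | 0 => rfl
    | 1 => rfl
    | j + 2 => simp [raiseLogCoeff, hb j (by omega)]
  · intro j hj hodd
    match j with
    | 0 => simp at hodd
    | 1 => rfl
    | j + 2 =>
      have hodd' : Odd j := by simpa [Nat.odd_add] using hodd
      -- `j` is odd and `m` is even, so that `j < m` and the logarithmic coefficient vanishes too.
      have hjm : j ≠ m := fun e => (Nat.not_odd_iff_even.2 hm) (e ▸ hodd')
      simp [raiseCoeff, ha j (by omega) hodd', hb j (by omega)]

theorem isPowerExpansion_exp_neg :
    IsPowerExpansion (fun r => Real.exp (-r)) fun j => (-1) ^ j / (j.factorial : ℝ) := by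
  intro r _
  have h := NormedSpace.expSeries_div_hasSum_exp (-r)
  rw [← Real.exp_eq_exp_ℝ] at h
  refine h.congr_fun fun j => ?_
  rw [neg_pow]
  ring

theorem exists_expansion_besselK_half (n : ℕ) : ∃ c : ℕ → ℝ, IsPowerExpansion
    (fun r => Real.sqrt (2 / Real.pi) * besselK ((n : ℝ) + 1 / 2) r * r ^ ((n : ℝ) + 1 / 2)) c ∧
    IsFirstNonEvenPower c (2 * n + 1)
      ((-1 : ℝ) ^ (n + 1) / ∏ k ∈ Finset.range (n + 1), (2 * (k : ℝ) + 1)) := by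
  induction n with
  | zero =>
    refine ⟨fun j => (-1) ^ j / (j.factorial : ℝ), fun r hr => ?_, ?_⟩
    · simp only [Nat.cast_zero, zero_add, sqrt_two_div_pi_mul_besselK_one_half hr]
      exact isPowerExpansion_exp_neg r hr
    · refine ⟨odd_one, by simp, by simp, fun j hj hodd => ?_⟩
      obtain rfl : j = 0 := by omega
      simp at hodd
  | succ n ih =>
    obtain ⟨c, hc, hfirst⟩ := ih
    obtain ⟨C, hC⟩ := (isPowerExpansion_iff_isLogPowerExpansion.1 hc).raise
      (g := fun r => Real.sqrt (2 / Real.pi) * besselK (((n + 1 : ℕ) : ℝ) + 1 / 2) r *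
        r ^ (((n + 1 : ℕ) : ℝ) + 1 / 2)) (fun r hr => by
      have h := (hasDerivAt_besselK_mul_rpow ((n : ℝ) + 1 / 2) hr).const_mul
        (Real.sqrt (2 / Real.pi))
      have e : ((n + 1 : ℕ) : ℝ) + 1 / 2 = (n : ℝ) + 1 / 2 + 1 := by push_cast; ring
      simp only [e, mul_assoc]
      exact h.congr_deriv (by ring))
    rw [raiseLogCoeff_zero] at hC
    refine ⟨_, isPowerExpansion_iff_isLogPowerExpansion.2 hC, ?_⟩
    refine (congrArg (IsFirstNonEvenPower _ _) ?_).mp (hfirst.raise C)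
    rw [Finset.prod_range_succ _ (n + 1), pow_succ]
    push_cast
    have : (2 * (n : ℝ) + 1 + 2) ≠ 0 := by positivity
    rw [show 2 * ((n : ℝ) + 1) + 1 = 2 * n + 1 + 2 by ring, ← div_div]
    ring

theorem exists_expansion_besselK_natCast (n : ℕ) : ∃ a b : ℕ → ℝ,
    IsLogPowerExpansion (fun r => besselK (n : ℝ) r * r ^ n) a b ∧ IsFirstNonEvenLog a b (2 * n)
      ((-1 : ℝ) ^ (n + 1) * ((2 : ℝ) ^ (-(n : ℤ)) / (n.factorial : ℝ))) := by
  induction n with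
  | zero =>
    obtain ⟨a, b, h, hb⟩ := exists_isLogPowerExpansion_besselK_zero
    refine ⟨a, b, by simpa using h, by simp, by simpa using hb, by simp, fun j hj hodd => ?_⟩
    obtain rfl : j = 0 := by omega
    simp at hodd
  | succ n ih =>
    obtain ⟨a, b, hab, hfirst⟩ := ih
    obtain ⟨C, hC⟩ := hab.raise (g := fun r => besselK ((n + 1 : ℕ) : ℝ) r * r ^ (n + 1))
      (fun r hr => by
        have h := hasDerivAt_besselK_mul_rpow (n : ℝ) hr
        simp only [← Nat.cast_succ, Real.rpow_natCast] at h
        exact h)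
    refine ⟨_, _, hC, ?_⟩
    refine (congrArg (IsFirstNonEvenLog _ _ _) ?_).mp (hfirst.raise (even_two_mul n) C)
    simp only [zpow_neg, zpow_natCast]
    rw [Nat.factorial_succ]
    push_cast
    field_simp
    ring

theorem prod_range_odd_mul_two_pow_mul_factorial (n : ℕ) :
    (∏ k ∈ Finset.range (n + 1), (2 * (k : ℝ) + 1)) * (2 ^ n * (n.factorial : ℝ)) =
      ((2 * n + 1).factorial : ℝ) := by
  induction n with
  | zero => simp
  | succ n ih =>
    rw [Finset.prod_range_succ, show 2 * (n + 1) + 1 = 2 * n + 1 + 1 + 1 by ring,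
      Nat.factorial_succ (2 * n + 1 + 1), Nat.factorial_succ (2 * n + 1), Nat.factorial_succ n]
    push_cast
    rw [← ih]
    ring

theorem theorem6p1 (n : ℕ) :
    ((∃ c : ℕ → ℝ, IsPowerExpansion
        (fun r => Real.sqrt (2 / Real.pi) * besselK ((n : ℝ) + 1 / 2) r * r ^ ((n : ℝ) + 1 / 2)) c) ∧
      (∀ c : ℕ → ℝ, IsPowerExpansion
        (fun r => Real.sqrt (2 / Real.pi) * besselK ((n : ℝ) + 1 / 2) r * r ^ ((n : ℝ) + 1 / 2)) c →
        IsFirstNonEvenPower c (2 * n + 1)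
          ((-1 : ℝ) ^ (n + 1) / ∏ k ∈ Finset.range (n + 1), (2 * (k : ℝ) + 1))) ∧
      (-1 : ℝ) ^ (n + 1) / ∏ k ∈ Finset.range (n + 1), (2 * (k : ℝ) + 1) =
        (-1 : ℝ) ^ (n + 1) * 2 ^ n * (n.factorial : ℝ) / ((2 * n + 1).factorial : ℝ)) ∧
    ((∃ a b : ℕ → ℝ, IsLogPowerExpansion (fun r => besselK (n : ℝ) r * r ^ n) a b) ∧
      (∀ a b : ℕ → ℝ, IsLogPowerExpansion (fun r => besselK (n : ℝ) r * r ^ n) a b →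
        IsFirstNonEvenLog a b (2 * n)
          ((-1 : ℝ) ^ (n + 1) * ((2 : ℝ) ^ (-(n : ℤ)) / (n.factorial : ℝ))))) := by
  obtain ⟨c, hc, hfirst⟩ := exists_expansion_besselK_half n
  obtain ⟨a, b, hab, hfirst'⟩ := exists_expansion_besselK_natCast n
  refine ⟨⟨⟨c, hc⟩, fun c' hc' => ?_, ?_⟩, ⟨a, b, hab⟩, fun a' b' hab' => ?_⟩
  · rw [isPowerExpansion_iff_isLogPowerExpansion] at hc hc'
    rwa [← (hc.unique hc').1]
  · have hprod : (∏ k ∈ Finset.range (n + 1), (2 * (k : ℝ) + 1)) ≠ 0 :=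
      Finset.prod_ne_zero_iff.2 fun k _ => by positivity
    have hfac : (n.factorial : ℝ) ≠ 0 := by exact_mod_cast n.factorial_ne_zero
    rw [← prod_range_odd_mul_two_pow_mul_factorial]
    field_simp
  · obtain ⟨rfl, rfl⟩ := hab.unique hab'
    exact hfirst'
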